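/- Let $X$ be a connected compact smooth ($C^\infty$, Hausdorff, without boundary) manifold of dimension $n\ge 0$, and let $\Phi\colon\mathbb{R}\times X\to X$ be a smooth flow. Assume that $(X,\Phi)$ can be linearized by a smooth embedding, that is, there are $m\in\mathbb{N}$, a smooth embedding $F\colon X\to\mathbb{R}^m$ and a matrix $B\in\mathbb{R}^{m\times m}$ such that $F\circ\Phi^t=e^{Bt}\circ F$ for all $t\in\mathbb{R}$. Assume also that $\Phi$ has at least one isolated equilibrium (a point $x$ with $\Phi^t(x)=x$ for all $t\in\mathbb{R}$ that has a neighborhood containing no other such point). Then $n$ is even, and the Hopf index of the vector field $x\mapsto \frac{d}{dt}\big|_{t=0}\Phi^t(x)$ generating $\Phi$ at every isolated equilibrium of $\Phi$ is equal to $1$. Here the Hopf index of a vector field at an isolated zero $x$ is computed in any smooth chart around $x$: if $v$ is the expression of the vector field in the chart and $z$ is the image of $x$, it is the degree of the map $v/\|v\|$ from the sphere of any sufficiently small radius about $z$ to the unit sphere $S^{n-1}$, where the degree of a smooth map is the number of preimages of a regular value, each counted with the sign $\pm1$ by which the differential acts on orientations. If $n=0$, the spheres are empty and the index is $1$ by convention.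 -/

import Mathlib

open scoped Manifold ContDiff Topology

noncomputable section

namespace LinFlow

/-- Euclidean space `ℝⁿ`. -/
abbrev E (n : ℕ) : Type := EuclideanSpace ℝ (Fin n)

/-! ### The degree of a smooth self-map of the unit sphere of `ℝⁿ` -/

/-- For a map `f`, smooth near the unit sphere of `ℝⁿ` and mapping this sphere to itself, and for a
unit vector `u`, this is the linear map `ℝⁿ → ℝⁿ` that sends the outward normal `u` at `u` to the
outward normal `f u` at `f u`, and that is `df_u : T_u S → T_{f u} S` on the tangent space
`T_u S = u^⊥` of the sphere. It is invertible iff `df_u` is, and (the sphere being oriented as the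
boundary of the ball) `df_u` then preserves or reverses orientation according to the sign of its
determinant. -/
def sphereDeriv {n : ℕ} (f : E n → E n) (u : E n) : E n →L[ℝ] E n :=
  (innerSL ℝ u).smulRight (f u) +
    (fderiv ℝ f u).comp (ContinuousLinearMap.id ℝ (E n) - (innerSL ℝ u).smulRight u)

/-- The unit vector `y` is a regular value of the self-map of the unit sphere given by `f`. -/
def IsSphereRegularValue {n : ℕ} (f : E n → E n) (y : E n) : Prop :=
  ‖y‖ = 1 ∧ ∀ u : E n, ‖u‖ = 1 → f u = y → (sphereDeriv f u).det ≠ 0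

/-- `f` restricts to a smooth self-map of the unit sphere of `ℝⁿ` (`n ≥ 1`), and this self-map has
degree `k`: the number of preimages of a regular value, counted with the sign by which `f` acts on
orientations, is `k`. For `n = 0` the sphere is empty, and its only self-map, the identity,
has degree `1`. -/
structure HasSphereDegree {n : ℕ} (f : E n → E n) (k : ℤ) : Prop where
  contDiffAt : ∀ u : E n, ‖u‖ = 1 → ContDiffAt ℝ ∞ f u
  mapsTo : ∀ u : E n, ‖u‖ = 1 → ‖f u‖ = 1
  exists_regular : n ≠ 0 → ∃ y, IsSphereRegularValue f y
  count : ∀ y, IsSphereRegularValue f y →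
    ∃ s : Finset (E n), (∀ u, u ∈ s ↔ ‖u‖ = 1 ∧ f u = y) ∧
      ∑ u ∈ s, ((SignType.sign (sphereDeriv f u).det : SignType) : ℤ) = k
  dim_zero : n = 0 → k = 1

theorem HasSphereDegree.unique {n : ℕ} {f : E n → E n} {k l : ℤ}
    (hk : HasSphereDegree f k) (hl : HasSphereDegree f l) : k = l := by
  by_cases hn : n = 0
  · rw [hk.dim_zero hn, hl.dim_zero hn]
  · obtain ⟨y, hy⟩ := hk.exists_regular hn
    obtain ⟨s, hs, rfl⟩ := hk.count y hy
    obtain ⟨t, ht, rfl⟩ := hl.count y hy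
    have hst : s = t := by
      ext u
      rw [hs, ht]
    rw [hst]

/-- The vector field `v` on (an open subset of) `ℝⁿ` has Hopf index `k` at `z`: for all small
`r > 0`, the map `v / ‖v‖` from the sphere of radius `r` about `z` to the unit sphere (written as
a self-map of the unit sphere by means of `u ↦ z + r u`) has degree `k`. -/
def HasIndexAt {n : ℕ} (v : E n → E n) (z : E n) (k : ℤ) : Prop :=
  ∀ᶠ r : ℝ in 𝓝[>] 0, HasSphereDegree (fun u => ‖v (z + r • u)‖⁻¹ • v (z + r • u)) k

/-! ### Vector fields and flows on manifolds -/

variable {n : ℕ} {X : Type*} [TopologicalSpace X] [ChartedSpace (E n) X]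

/-- The expression of the vector field `V` in the chart `φ`. -/
def chartRep (V : ∀ x : X, TangentSpace (𝓡 n) x) (φ : OpenPartialHomeomorph X (E n)) (y : E n) :
    E n :=
  mfderiv (𝓡 n) 𝓘(ℝ, E n) φ (φ.symm y) (V (φ.symm y))

/-- The vector field `V` on the manifold `X` has Hopf index `k` at `x`: its expression in any
smooth chart `φ` around `x` has index `k` at `φ x`. -/
def HasHopfIndex (V : ∀ x : X, TangentSpace (𝓡 n) x) (x : X) (k : ℤ) : Prop :=
  ∀ φ ∈ IsManifold.maximalAtlas (𝓡 n) ∞ X, x ∈ φ.source → HasIndexAt (chartRep V φ) (φ x) k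

theorem HasHopfIndex.unique [IsManifold (𝓡 n) ∞ X] {V : ∀ x : X, TangentSpace (𝓡 n) x} {x : X}
    {k l : ℤ} (hk : HasHopfIndex V x k) (hl : HasHopfIndex V x l) : k = l := by
  have hφ := IsManifold.chart_mem_maximalAtlas (I := 𝓡 n) (n := ∞) x
  have hx := mem_chart_source (E n) x
  obtain ⟨r, h1, h2⟩ := ((hk _ hφ hx).and (hl _ hφ hx)).exists
  exact h1.unique h2

/-- The flow `Φ` is smooth as a map `ℝ × X → X`. -/
def IsSmoothFlow (n : ℕ) {X : Type*} [TopologicalSpace X] [ChartedSpace (E n) X]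
    (Φ : Flow ℝ X) : Prop :=
  ContMDiff (𝓘(ℝ, ℝ).prod (𝓡 n)) (𝓡 n) ∞ (fun p : ℝ × X => Φ p.1 p.2)

/-- The vector field generating the flow `Φ`: its value at `x` is the velocity at time `0` of the
curve `t ↦ Φ t x`. -/
def generator (n : ℕ) {X : Type*} [TopologicalSpace X] [ChartedSpace (E n) X]
    (Φ : Flow ℝ X) (x : X) : TangentSpace (𝓡 n) x :=
  mfderiv 𝓘(ℝ, ℝ) (𝓡 n) (fun t : ℝ => Φ t x) 0 (1 : ℝ)

/-- `x` is an equilibrium of the flow `Φ`. -/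
def IsEquilibrium {X : Type*} [TopologicalSpace X] (Φ : Flow ℝ X) (x : X) : Prop :=
  ∀ t : ℝ, Φ t x = x

/-- `x` is an equilibrium of `Φ` and some neighbourhood of `x` contains no other one. -/
def IsIsolatedEquilibrium {X : Type*} [TopologicalSpace X] (Φ : Flow ℝ X) (x : X) : Prop :=
  IsEquilibrium Φ x ∧ ∀ᶠ y in 𝓝[≠] x, ¬ IsEquilibrium Φ y

/-- `(X, Φ)` is linearizable by a smooth embedding: there are a smooth embedding `F : X → ℝᵐ`
and a real `m × m` matrix `B` such that `F ∘ Φᵗ = exp (t B) ∘ F` for all `t`. -/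
def IsSmoothlyLinearizable (n : ℕ) {X : Type*} [TopologicalSpace X] [ChartedSpace (E n) X]
    (Φ : Flow ℝ X) : Prop :=
  ∃ (m : ℕ) (F : X → E m) (B : Matrix (Fin m) (Fin m) ℝ),
    Manifold.IsSmoothEmbedding (𝓡 n) (𝓡 m) ∞ F ∧
      ∀ (t : ℝ) (x : X), F (Φ t x) = Matrix.toEuclideanCLM (𝕜 := ℝ) (NormedSpace.exp (t • B)) (F x)

end LinFlow

end

noncomputable section

namespace LinFlow

open Filter Set
open scoped NNReal

/-! Let `v` be the generator in a chart, `G` the embedding read there, `z` an isolated zero, `L =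
Dv(z)` and `D = DG(z)`. The linearization gives `DG(y) v(y) = B (G y)`, hence `D L = B D` with `D`
injective. The whole theorem follows once `L` is known to have no real eigenvalue: its
characteristic polynomial is then positive on `ℝ`, so `det L` and `det (-L)` are positive, `n` is
even and the index, the sign of `det L`, is `1`.

Since `X` is compact, `G` takes values in the subspace of vectors with bounded `exp(tB)`-orbit, on
which the group is uniformly bounded. An eigenvalue `c ≠ 0` of `L` would be one of `B` there and
give growth `exp(tc)`. For `c = 0`, averaging yields a projection onto the range of `D` that
commutes with `B`. It turns `G - G z` into a local coordinate `g` at `z` that carries `v` to the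
linear field `L`, so a kernel vector of `L` would produce zeros of `v` accumulating at `z`
(`no_eigenvector_of_isolated_zero`).

The index is computed in `hasIndexAt_one_of_det_pos` without homotopies: on small spheres the
rescaled field is `C¹`-close to `L`, and its degree-one homogeneous extension is a bijection of
`ℝⁿ`. -/

/-! ### Endomorphisms of `ℝⁿ` without real eigenvalues -/

theorem det_pos_of_no_eigenvector {n : ℕ} (A : E n →L[ℝ] E n)
    (h : ∀ (c : ℝ) (w : E n), A w = c • w → w = 0) (c : ℝ) :
    0 < LinearMap.det (c • LinearMap.id - (A : E n →ₗ[ℝ] E n)) := by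
  have key : ∀ c : ℝ, (A : E n →ₗ[ℝ] E n).charpoly.eval c =
      LinearMap.det (c • LinearMap.id - (A : E n →ₗ[ℝ] E n)) := by
    intro c
    rw [LinearMap.eval_charpoly]
    rfl
  have hne : ∀ c : ℝ, (A : E n →ₗ[ℝ] E n).charpoly.eval c ≠ 0 := by
    intro c hc
    have := (Module.End.hasEigenvalue_iff_isRoot_charpoly (A : E n →ₗ[ℝ] E n) c).2 hc
    obtain ⟨w, hw⟩ := this.exists_hasEigenvector
    exact hw.2 (h c w hw.apply_eq_smul)
  rw [← key]
  by_contra hneg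
  rcases Nat.eq_zero_or_pos n with rfl | hn
  · apply hneg
    have h1 : (A : E 0 →ₗ[ℝ] E 0).charpoly = 1 := by
      apply (LinearMap.charpoly_monic _).natDegree_eq_zero.1
      simp [LinearMap.charpoly_natDegree]
    simp [h1]
  · have hdeg : 0 < (A : E n →ₗ[ℝ] E n).charpoly.degree := by
      rw [Polynomial.degree_eq_natDegree (LinearMap.charpoly_monic _).ne_zero,
        LinearMap.charpoly_natDegree]
      simpa using hn
    -- A nonpositive value at `c` and a positive one further right would enclose a real root.
    have ht := Polynomial.tendsto_atTop_of_leadingCoeff_nonneg _ hdeg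
      (by rw [LinearMap.charpoly_monic _]; exact zero_le_one)
    obtain ⟨d, hd, hcd⟩ := ((ht.eventually_gt_atTop 0).and (eventually_ge_atTop c)).exists
    obtain ⟨e, -, he⟩ := intermediate_value_Icc hcd
      (Polynomial.continuous _).continuousOn ⟨not_lt.1 hneg, hd.le⟩
    exact hne e he

/-- `A` and `-A` both have positive determinant, while `det (-A) = (-1)ⁿ det A`. -/
theorem det_pos_and_even_of_no_eigenvector {n : ℕ} (A : E n →L[ℝ] E n)
    (h : ∀ (c : ℝ) (w : E n), A w = c • w → w = 0) : 0 < A.det ∧ Even n := by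
  have h1 := det_pos_of_no_eigenvector A h 0
  have h2 := det_pos_of_no_eigenvector (-A) (fun c w hw => h (-c) w (by
    rw [neg_smul, ← hw]; simp)) 0
  have h3 : 0 < A.det := by simpa [ContinuousLinearMap.det] using h2
  refine ⟨h3, ?_⟩
  by_contra hodd
  have h4 : (0 : ℝ) • LinearMap.id - (A : E n →ₗ[ℝ] E n) =
      (-1 : ℝ) • (A : E n →ₗ[ℝ] E n) := by simp
  rw [h4, LinearMap.det_smul, finrank_euclideanSpace_fin,
    (Nat.not_even_iff_odd.1 hodd).neg_one_pow] at h1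
  have h5 : 0 < LinearMap.det (A : E n →ₗ[ℝ] E n) := h3
  linarith

/-! ### Averaging over a bounded one-parameter group, and linearization at a zero -/

section Averaging

variable {V : Type*} [NormedAddCommGroup V] [NormedSpace ℝ V] [FiniteDimensional ℝ V]

theorem hasDerivAt_exp_smul_conj (B Q : V →L[ℝ] V) (t : ℝ) :
    HasDerivAt (fun s : ℝ => NormedSpace.exp (s • (-B)) * Q * NormedSpace.exp (s • B))
      (NormedSpace.exp (t • (-B)) * Q * NormedSpace.exp (t • B) * B -
        B * (NormedSpace.exp (t • (-B)) * Q * NormedSpace.exp (t • B))) t := by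
  have : CompleteSpace V := FiniteDimensional.complete ℝ V
  have h := ((hasDerivAt_exp_smul_const' (𝕂 := ℝ) (-B) t).mul_const Q).mul
    (hasDerivAt_exp_smul_const (𝕂 := ℝ) B t)
  refine h.congr_deriv ?_
  rw [neg_mul, neg_mul, neg_mul, ← mul_assoc, ← mul_assoc, ← mul_assoc, add_comm, ← sub_eq_add_neg]

theorem exp_neg_smul_mul_exp_smul (B : V →L[ℝ] V) (t : ℝ) :
    NormedSpace.exp (t • (-B)) * NormedSpace.exp (t • B) = 1 := by
  have : CompleteSpace V := FiniteDimensional.complete ℝ V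
  let : NormedAlgebra ℚ (V →L[ℝ] V) := NormedAlgebra.restrictScalars ℚ ℝ _
  rw [← NormedSpace.exp_add_of_commute (by simp [commute_iff_eq])]
  simp

/-- A bounded one-parameter group of linear maps has an equivariant projection onto every invariant
subspace. -/
theorem exists_commuting_projection (B : V →L[ℝ] V) {C : ℝ}
    (hC : ∀ t : ℝ, ‖NormedSpace.exp (t • B)‖ ≤ C) (W : Submodule ℝ V) (hW : ∀ w ∈ W, B w ∈ W) :
    ∃ P : V →L[ℝ] V, P * B = B * P ∧ (∀ v, P v ∈ W) ∧ ∀ w ∈ W, P w = w := by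
  have : CompleteSpace V := FiniteDimensional.complete ℝ V
  have hC0 : 0 ≤ C := (norm_nonneg _).trans (hC 0)
  have hcl : IsClosed (W : Set V) := W.closed_of_finiteDimensional
  have hexp : ∀ t : ℝ, ∀ w ∈ W, NormedSpace.exp (t • B) w ∈ W := by
    intro t w hw
    have hs := (NormedSpace.exp_series_hasSum_exp' (𝕂 := ℝ) (t • B))
    have hs' := (ContinuousLinearMap.apply ℝ V w).hasSum hs
    refine hcl.mem_of_tendsto hs' (Eventually.of_forall fun s => W.sum_mem fun k _ => ?_)
    simp only [map_smul]
    refine W.smul_mem _ ?_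
    simp only [ContinuousLinearMap.apply_apply]
    clear * - hw hW
    induction k with
    | zero => simpa using hw
    | succ k ih => rw [pow_succ']; exact W.smul_mem _ (hW _ ih)
  obtain ⟨q, hq⟩ := W.subtype.exists_leftInverse_of_injective W.ker_subtype
  set P₀ : V →L[ℝ] V := LinearMap.toContinuousLinearMap (W.subtype ∘ₗ q) with hP₀
  have hP₀W : ∀ v, P₀ v ∈ W := fun v => (q v).2
  have hP₀id : ∀ w ∈ W, P₀ w = w := by
    intro w hw
    have := congrArg Subtype.val (LinearMap.congr_fun hq ⟨w, hw⟩)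
    simpa [hP₀] using this
  set Q : ℝ → V →L[ℝ] V :=
    fun s => NormedSpace.exp (s • (-B)) * P₀ * NormedSpace.exp (s • B) with hQ
  have hQd : ∀ t, HasDerivAt Q (Q t * B - B * Q t) t := hasDerivAt_exp_smul_conj B P₀
  have hQc : Continuous Q := continuous_iff_continuousAt.2 fun t => (hQd t).continuousAt
  -- A compact convex set of projections onto `W`. It contains every conjugate `Q t`, hence also
  -- their time averages and the limits of these.
  set K : Set (V →L[ℝ] V) :=
    {R | (∀ v, R v ∈ W) ∧ ∀ w ∈ W, R w = w} ∩ Metric.closedBall 0 (C * ‖P₀‖ * C) with hK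
  have hev : ∀ v : V, Continuous fun R : V →L[ℝ] V => R v :=
    fun v => (ContinuousLinearMap.apply ℝ V v).continuous
  have hKcl : IsClosed K := by
    refine IsClosed.inter ?_ Metric.isClosed_closedBall
    simp only [ofPred_and, ofPred_forall]
    refine (isClosed_iInter fun v => hcl.preimage (hev v)).inter
      (isClosed_iInter fun w => isClosed_iInter fun _ => isClosed_eq (hev w) continuous_const)
  have hKco : IsCompact K := by
    have : ProperSpace (V →L[ℝ] V) := FiniteDimensional.proper ℝ _
    exact (isCompact_closedBall _ _).of_isClosed_subset hKcl inter_subset_right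
  have hKcv : Convex ℝ K := by
    refine Convex.inter ?_ (convex_closedBall _ _)
    rintro R₁ ⟨h1, h1'⟩ R₂ ⟨h2, h2'⟩ a b _ _ hab
    refine ⟨fun v => W.add_mem (W.smul_mem _ (h1 v)) (W.smul_mem _ (h2 v)), fun w hw => ?_⟩
    simp [h1' w hw, h2' w hw, ← add_smul, hab]
  have hneg : ∀ s : ℝ, s • (-B) = (-s) • B := by intro s; simp
  have hQK : ∀ t, Q t ∈ K := by
    intro t
    refine ⟨⟨fun v => ?_, fun w hw => ?_⟩, ?_⟩
    · have : Q t v = NormedSpace.exp ((-t) • B) (P₀ (NormedSpace.exp (t • B) v)) := by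
        simp [hQ]
      rw [this]
      exact hexp _ _ (hP₀W _)
    · have h1 : Q t w = NormedSpace.exp (t • (-B)) (P₀ (NormedSpace.exp (t • B) w)) := rfl
      rw [h1, hP₀id _ (hexp t w hw), ← mul_apply_eq_comp, exp_neg_smul_mul_exp_smul]
      rfl
    · rw [mem_closedBall_zero_iff]
      refine (norm_mul_le _ _).trans (mul_le_mul ((norm_mul_le _ _).trans ?_) (hC t)
        (norm_nonneg _) (by positivity))
      rw [hneg]
      exact mul_le_mul_of_nonneg_right (hC _) (norm_nonneg _)
  set P : ℕ → V →L[ℝ] V := fun k => ⨍ t in (0 : ℝ)..((k : ℝ) + 1), Q t with hP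
  have hPK : ∀ k, P k ∈ K := by
    intro k
    refine hKcv.set_average_mem hKcl ?_ ?_ (Eventually.of_forall hQK) ?_
    · rw [uIoc_of_le (by positivity), Real.volume_Ioc]
      simp; positivity
    · rw [uIoc_of_le (by positivity), Real.volume_Ioc]
      simp
    · exact (hQc.intervalIntegrable 0 ((k : ℝ) + 1)).def'
  set ad : (V →L[ℝ] V) →L[ℝ] (V →L[ℝ] V) :=
    (ContinuousLinearMap.mul ℝ (V →L[ℝ] V)).flip B - ContinuousLinearMap.mul ℝ (V →L[ℝ] V) B
    with had
  have had' : ∀ R, ad R = R * B - B * R := fun R => by simp [had]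
  -- The commutator of `Q t` with `B` is the derivative of `Q`, so its average telescopes to a
  -- bounded difference divided by the length `k + 1`.
  have hadP : ∀ k, ‖ad (P k)‖ ≤ 2 * (C * ‖P₀‖ * C) * (1 / ((k : ℝ) + 1)) := by
    intro k
    have h1 : ∫ t in (0 : ℝ)..((k : ℝ) + 1), ad (Q t) = Q (k + 1) - Q 0 := by
      simp_rw [had']
      refine intervalIntegral.integral_eq_sub_of_hasDerivAt (fun t _ => hQd t) ?_
      exact ((hQc.mul continuous_const).sub (continuous_const.mul hQc)).intervalIntegrable _ _
    have h2 : ad (P k) = ((k : ℝ) + 1)⁻¹ • (Q (k + 1) - Q 0) := by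
      rw [← h1, ad.intervalIntegral_comp_comm (hQc.intervalIntegrable _ _), hP]
      simp only [interval_average_eq, sub_zero, map_smul]
    rw [h2, norm_smul, norm_inv, Real.norm_of_nonneg (by positivity : (0 : ℝ) ≤ (k : ℝ) + 1),
      mul_comm, one_div]
    gcongr
    have h3 := mem_closedBall_zero_iff.1 (hQK (k + 1)).2
    have h4 := mem_closedBall_zero_iff.1 (hQK 0).2
    linarith [norm_sub_le (Q (k + 1)) (Q 0)]
  obtain ⟨R, hRK, f, hf, hlim⟩ := hKco.tendsto_subseq hPK
  refine ⟨R, ?_, hRK.1⟩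
  have h1 : Tendsto (fun k => ad (P (f k))) atTop (𝓝 (ad R)) :=
    (ad.continuous.tendsto R).comp hlim
  have h2 : Tendsto (fun k => ad (P (f k))) atTop (𝓝 0) := by
    refine Tendsto.comp (g := fun k => ad (P k)) ?_ hf.tendsto_atTop
    refine squeeze_zero_norm hadP ?_
    simpa using (tendsto_one_div_add_atTop_nhds_zero_nat (𝕜 := ℝ)).const_mul
      (2 * (C * ‖P₀‖ * C))
  have h3 := tendsto_nhds_unique h1 h2
  rw [had'] at h3
  exact sub_eq_zero.1 h3

/-- Let a vector field `v` with an isolated zero `z` be conjugated by an immersion to a linear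
vector field generating a bounded group. Then the derivative of `v` at `z` has no real
eigenvalue. -/
theorem no_eigenvector_of_isolated_zero {n : ℕ} (B : V →L[ℝ] V) {C : ℝ}
    (hC : ∀ t : ℝ, ‖NormedSpace.exp (t • B)‖ ≤ C) {v : E n → E n} {G : E n → V} {z : E n}
    (hv : DifferentiableAt ℝ v z) (hG : ContDiffAt ℝ 2 G z)
    (heq : ∀ᶠ y in 𝓝 z, fderiv ℝ G y (v y) = B (G y))
    (hinj : Function.Injective (fderiv ℝ G z)) (hvz : v z = 0)
    (hiso : ∀ᶠ y in 𝓝[≠] z, v y ≠ 0) (c : ℝ) (w : E n) (hw : fderiv ℝ v z w = c • w) :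
    w = 0 := by
  have : CompleteSpace V := FiniteDimensional.complete ℝ V
  set D := fderiv ℝ G z with hD
  set L := fderiv ℝ v z with hL
  have hGd : DifferentiableAt ℝ G z := hG.differentiableAt (by norm_num)
  have hG' : DifferentiableAt ℝ (fderiv ℝ G) z :=
    (hG.fderiv_right (m := 1) (by norm_num)).differentiableAt (by norm_num)
  -- Differentiate `heq` at `z`; the second-derivative term of `G` is applied to `v z = 0` and drops
  -- out.
  have hDL : ∀ w, D (L w) = B (D w) := by
    intro w
    have h1 := (hG'.hasFDerivAt.clm_apply hv.hasFDerivAt)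
    have h2 : HasFDerivAt (fun y => B (G y)) (B.comp D) z := B.hasFDerivAt.comp z hGd.hasFDerivAt
    have h3 := h1.unique (h2.congr_of_eventuallyEq heq)
    have h4 := DFunLike.congr_fun h3 w
    simpa [hvz] using h4
  by_cases hc : c = 0
  · subst hc
    rw [zero_smul] at hw
    by_contra hw0
    set W : Submodule ℝ V := LinearMap.range (D : E n →ₗ[ℝ] V) with hWdef
    obtain ⟨P, hPB, hPW, hPid⟩ := exists_commuting_projection B hC W (by
      rintro _ ⟨w, rfl⟩
      exact ⟨L w, hDL w⟩)
    obtain ⟨l, hl⟩ := (D : E n →ₗ[ℝ] V).exists_leftInverse_of_injective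
      (LinearMap.ker_eq_bot.2 hinj)
    have hlD : ∀ w, l (D w) = w := fun w => LinearMap.congr_fun hl w
    have hDl : ∀ u ∈ W, D (l u) = u := by
      rintro _ ⟨w, rfl⟩
      exact congrArg D (hlD w)
    -- A left inverse of `D` that also intertwines `B` with `L`, because `P` commutes with `B`.
    set lc : V →L[ℝ] E n := (LinearMap.toContinuousLinearMap l).comp P with hlc
    have hlcD : ∀ w, lc (D w) = w := by
      intro w
      simp only [hlc, ContinuousLinearMap.comp_apply, LinearMap.coe_toContinuousLinearMap']
      rw [hPid (D w) ⟨w, rfl⟩, hlD]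
    have hlcB : ∀ u, lc (B u) = L (lc u) := by
      intro u
      have h1 : P (B u) = B (P u) := DFunLike.congr_fun hPB u
      simp only [hlc, ContinuousLinearMap.comp_apply, LinearMap.coe_toContinuousLinearMap', h1]
      conv_lhs => rw [← hDl _ (hPW u), ← hDL, hlD]
    have hBGz : B (G z) = 0 := by
      rw [← heq.self_of_nhds, hvz, map_zero]
    -- A local coordinate at `z` with `Dg(z) = id` and, near `z`, `Dg(y) v(y) = L (g y)`.
    set g : E n → E n := fun y => lc (G y - G z) with hg
    have hgz : g z = 0 := by simp [hg]
    have hGs : HasStrictFDerivAt G D z := hG.hasStrictFDerivAt (by norm_num)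
    have hgs : HasStrictFDerivAt g (ContinuousLinearMap.id ℝ (E n)) z := by
      have := lc.hasStrictFDerivAt.comp z (hGs.sub_const (G z))
      exact this.congr_fderiv (by ext1 w; exact hlcD w)
    have hmap : map g (𝓝 z) = 𝓝 0 := by
      rw [← hgz]
      exact hgs.map_nhds_eq_of_surj (by simp)
    have hinv : ∀ᶠ y in 𝓝 z, ∀ u, lc (fderiv ℝ G y u) = 0 → u = 0 := by
      have h1 : ContinuousAt (fun y => lc.comp (fderiv ℝ G y)) z :=
        (ContinuousLinearMap.compL ℝ (E n) V (E n) lc).continuous.continuousAt.comp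
          hG'.continuousAt
      have h2 : lc.comp (fderiv ℝ G z) = 1 := by ext1 w; exact hlcD w
      have h3 : ∀ᶠ y in 𝓝 z, IsUnit (lc.comp (fderiv ℝ G y)) := by
        refine h1.eventually (p := fun T => IsUnit T) (Units.isOpen.mem_nhds ?_)
        change IsUnit (lc.comp (fderiv ℝ G z))
        rw [h2]
        exact isUnit_one
      filter_upwards [h3] with y hy u hu
      obtain ⟨e, he⟩ := hy
      have h4 : (e : E n →L[ℝ] E n) u = 0 := by rw [he]; exact hu
      have h5 : (↑e⁻¹ * (e : E n →L[ℝ] E n)) u = 0 := by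
        rw [mul_apply_eq_comp, h4, map_zero]
      simpa using h5
    -- `Dg(y)` is injective near `z`, so `L (g y) = 0` would force `v y = 0`.
    have hgood : ∀ᶠ y in 𝓝 z, y ≠ z → L (g y) ≠ 0 := by
      filter_upwards [hinv, heq, eventually_nhdsWithin_iff.1 hiso] with y h1 h2 h3 hyz hLg
      refine h3 hyz (h1 _ ?_)
      rw [h2, hlcB, ← hLg, hg]
      simp only [map_sub, ← hlcB, hBGz, map_zero, sub_zero]
    have hgood' : ∀ᶠ p in 𝓝 (0 : E n), ∃ y, (y ≠ z → L (g y) ≠ 0) ∧ g y = p := by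
      rw [← hmap, eventually_map]
      filter_upwards [hgood] with y hy using ⟨y, hy, rfl⟩
    -- Small nonzero multiples of the kernel vector `w` are values `g y` with `y ≠ z` and `L (g y) =
    -- 0`.
    have hline : Tendsto (fun s : ℝ => s • w) (𝓝[≠] 0) (𝓝 0) := by
      refine tendsto_nhdsWithin_of_tendsto_nhds ?_
      have : Continuous fun s : ℝ => s • w := by fun_prop
      simpa using this.tendsto 0
    obtain ⟨s, ⟨y, hy, hgy⟩, hs⟩ :=
      ((hline.eventually hgood').and eventually_mem_nhdsWithin).exists
    refine hy ?_ (by rw [hgy, map_smul, hw, smul_zero])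
    rintro rfl
    rw [hgz] at hgy
    exact (smul_ne_zero hs hw0) hgy.symm
  · set u := D w with hu
    have hBu : B u = c • u := by rw [hu, ← hDL, hw, map_smul]
    have hexp : ∀ t : ℝ, NormedSpace.exp (t • B) u = Real.exp (t * c) • u := by
      intro t
      have hs := (ContinuousLinearMap.apply ℝ V u).hasSum
        (NormedSpace.exp_series_hasSum_exp' (𝕂 := ℝ) (t • B))
      have hs' := (NormedSpace.exp_series_hasSum_exp' (𝕂 := ℝ) (t * c)).smul_const u
      rw [← Real.exp_eq_exp_ℝ] at hs'
      refine hs.unique (hs'.congr_fun ?_)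
      intro k
      have hk : (B ^ k) u = c ^ k • u := by
        induction k with
        | zero => simp
        | succ k ih =>
          rw [pow_succ', mul_apply_eq_comp, ih, map_smul, hBu, smul_smul, pow_succ]
      simp [smul_pow, hk, smul_smul, mul_pow, mul_assoc]
    by_contra hw0
    have hu0 : u ≠ 0 := fun h => hw0 (hinj (by rw [← hu, h, map_zero]))
    have hbd : ∀ t : ℝ, Real.exp (t * c) ≤ C := by
      intro t
      have h1 := ((NormedSpace.exp (t • B)).le_opNorm u).trans
        (mul_le_mul_of_nonneg_right (hC t) (norm_nonneg u))
      rw [hexp, norm_smul, Real.norm_of_nonneg (Real.exp_pos _).le] at h1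
      exact le_of_mul_le_mul_right h1 (norm_pos_iff.2 hu0)
    -- At `t = C / c` the bound reads `exp C ≤ C`, contrary to `C + 1 ≤ exp C`.
    have h1 := hbd (C / c)
    rw [div_mul_cancel₀ _ hc] at h1
    linarith [Real.add_one_le_exp C]

end Averaging

/-! ### Degree of nearly linear sphere maps, and the index of a nondegenerate zero -/

/-- The constant is `3 = 1 + 2`: changing the radius costs `ε ‖x - y‖` by the sup bound, changing
the direction `2 ε ‖x - y‖` by the Lipschitz bound. -/
theorem norm_radial_sub_le {n : ℕ} {e : E n → E n} {ε : ℝ}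
    (hb : ∀ u, ‖u‖ = 1 → ‖e u‖ ≤ ε)
    (hl : ∀ u u', ‖u‖ = 1 → ‖u'‖ = 1 → ‖e u - e u'‖ ≤ ε * ‖u - u'‖) (hε : 0 ≤ ε) (x y : E n) :
    ‖‖x‖ • e (‖x‖⁻¹ • x) - ‖y‖ • e (‖y‖⁻¹ • y)‖ ≤ 3 * ε * ‖x - y‖ := by
  have hunit : ∀ x : E n, x ≠ 0 → ‖‖x‖⁻¹ • x‖ = 1 := fun x hx => by
    simpa using norm_smul_inv_norm (𝕜 := ℝ) hx
  have hE : ∀ x : E n, ‖‖x‖ • e (‖x‖⁻¹ • x)‖ ≤ 3 * ε * ‖x‖ := by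
    intro x
    rcases eq_or_ne x 0 with rfl | hx
    · simp
    · rw [norm_smul, norm_norm, mul_comm]
      have := mul_le_mul_of_nonneg_right (hb _ (hunit x hx)) (norm_nonneg x)
      nlinarith [mul_nonneg hε (norm_nonneg x)]
  rcases eq_or_ne x 0 with rfl | hx
  · simpa [norm_neg] using hE y
  rcases eq_or_ne y 0 with rfl | hy
  · simpa using hE x
  have hxy : ‖‖y‖ • (‖x‖⁻¹ • x - ‖y‖⁻¹ • y)‖ ≤ 2 * ‖x - y‖ := by
    have h1 : ‖y‖ • (‖x‖⁻¹ • x - ‖y‖⁻¹ • y) = (‖y‖ - ‖x‖) • (‖x‖⁻¹ • x) + (x - y) := by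
      rw [smul_sub, sub_smul, smul_inv_smul₀ (norm_ne_zero_iff.2 hy),
        smul_inv_smul₀ (norm_ne_zero_iff.2 hx)]
      abel
    rw [h1]
    refine (norm_add_le _ _).trans ?_
    rw [norm_smul, hunit x hx, mul_one, Real.norm_eq_abs]
    have := abs_norm_sub_norm_le y x
    rw [norm_sub_rev] at this
    linarith
  have hdec : ‖x‖ • e (‖x‖⁻¹ • x) - ‖y‖ • e (‖y‖⁻¹ • y) =
      (‖x‖ - ‖y‖) • e (‖x‖⁻¹ • x) + ‖y‖ • (e (‖x‖⁻¹ • x) - e (‖y‖⁻¹ • y)) := by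
    rw [sub_smul, smul_sub]; abel
  rw [hdec]
  refine (norm_add_le _ _).trans ?_
  have h1 : ‖(‖x‖ - ‖y‖) • e (‖x‖⁻¹ • x)‖ ≤ ‖x - y‖ * ε := by
    rw [norm_smul, Real.norm_eq_abs]
    exact mul_le_mul (abs_norm_sub_norm_le x y) (hb _ (hunit x hx)) (norm_nonneg _) (norm_nonneg _)
  have h2 : ‖‖y‖ • (e (‖x‖⁻¹ • x) - e (‖y‖⁻¹ • y))‖ ≤ ε * (2 * ‖x - y‖) := by
    rw [norm_smul] at hxy ⊢
    calc ‖‖y‖‖ * ‖e (‖x‖⁻¹ • x) - e (‖y‖⁻¹ • y)‖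
        ≤ ‖‖y‖‖ * (ε * ‖‖x‖⁻¹ • x - ‖y‖⁻¹ • y‖) :=
          mul_le_mul_of_nonneg_left (hl _ _ (hunit x hx) (hunit y hy)) (norm_nonneg _)
      _ = ε * (‖‖y‖‖ * ‖‖x‖⁻¹ • x - ‖y‖⁻¹ • y‖) := by ring
      _ ≤ _ := mul_le_mul_of_nonneg_left hxy hε
  linarith

/-- The derivative at the unit vector `u` of the extension of `h` from the unit sphere that is
positively homogeneous of degree one. -/
def radialDeriv {n : ℕ} (h : E n → E n) (u : E n) : E n →L[ℝ] E n :=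
  (innerSL ℝ u).smulRight (h u) +
    (fderiv ℝ h u).comp (ContinuousLinearMap.id ℝ (E n) - (innerSL ℝ u).smulRight u)

/-- Differentiating `‖h‖⁻¹` only adds multiples of `h u`, the image of `u` under `radialDeriv h u`.
So normalizing amounts to a positive factor and a precomposition with a shear along `u`, of
determinant one. -/
theorem det_sphereDeriv_normalize_pos {n : ℕ} {h : E n → E n} {u : E n} (hu : ‖u‖ = 1)
    (hd : DifferentiableAt ℝ h u) (h0 : h u ≠ 0) (hdet : 0 < (radialDeriv h u).det) :
    0 < (sphereDeriv (fun u => ‖h u‖⁻¹ • h u) u).det := by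
  set c := ‖h u‖ with hc
  have hc0 : 0 < c := norm_pos_iff.2 h0
  obtain ⟨β, hβ⟩ : ∃ β : E n →L[ℝ] ℝ, HasFDerivAt (fun u => ‖h u‖⁻¹) β u :=
    ⟨_, ((hd.norm ℝ h0).inv hc0.ne').hasFDerivAt⟩
  have hf := (hβ.smul hd.hasFDerivAt).fderiv
  set π : E n →L[ℝ] E n := ContinuousLinearMap.id ℝ (E n) - (innerSL ℝ u).smulRight u with hπ
  have hπu : π u = 0 := by simp [hπ, hu]
  set M := radialDeriv h u with hM
  have hMu : M u = h u := by
    rw [hM, radialDeriv, ← hπ]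
    simp [hπu, hu]
  set τ : E n →ₗ[ℝ] E n :=
    LinearMap.transvection (c • ((β.comp π : E n →L[ℝ] ℝ) : E n →ₗ[ℝ] ℝ)) u with hτ
  have hS : ((sphereDeriv (fun u => ‖h u‖⁻¹ • h u) u : E n →L[ℝ] E n) : E n →ₗ[ℝ] E n) =
      c⁻¹ • ((M : E n →ₗ[ℝ] E n) ∘ₗ τ) := by
    ext1 x
    have e1 : M (τ x) = M x + (c * β (π x)) • h u := by
      rw [hτ, LinearMap.transvection.apply, map_add, map_smul, hMu]
      simp
    have e2 : M x = inner ℝ u x • h u + fderiv ℝ h u (π x) := by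
      rw [hM, radialDeriv, ← hπ]; simp
    have e3 : sphereDeriv (fun u => ‖h u‖⁻¹ • h u) u x =
        inner ℝ u x • c⁻¹ • h u + (c⁻¹ • fderiv ℝ h u (π x) + β (π x) • h u) := by
      rw [sphereDeriv, ← hπ]
      have : fderiv ℝ (fun u => ‖h u‖⁻¹ • h u) u = _ := hf
      rw [this]
      simp [hc]
    change sphereDeriv (fun u => ‖h u‖⁻¹ • h u) u x = c⁻¹ • M (τ x)
    rw [e1, e2, e3, smul_add, smul_add, smul_smul c⁻¹ (c * _), inv_mul_cancel_left₀ hc0.ne',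
      smul_comm, add_assoc]
  rw [ContinuousLinearMap.det, hS, LinearMap.det_smul, LinearMap.det_comp, hτ,
    LinearMap.transvection.det]
  have : 0 < LinearMap.det (M : E n →ₗ[ℝ] E n) := hdet
  simp [hπu]
  positivity

/-- A `C¹`-small perturbation of a linear automorphism of positive determinant induces, after
normalization, a self-map of the unit sphere of degree one. -/
theorem hasSphereDegree_normalize {n : ℕ} (L : E n ≃L[ℝ] E n) {h : E n → E n} {ε : ℝ≥0}
    (hsub : Subsingleton (E n) ∨ 3 * ε < ‖(L.symm : E n →L[ℝ] E n)‖₊⁻¹)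
    (hdet : ∀ M : E n →L[ℝ] E n, ‖M - L‖ ≤ 3 * ε → 0 < M.det)
    (hsm : ∀ u, ‖u‖ = 1 → ContDiffAt ℝ ∞ h u)
    (hb : ∀ u, ‖u‖ = 1 → ‖h u - L u‖ ≤ ε)
    (hl : ∀ u u', ‖u‖ = 1 → ‖u'‖ = 1 → ‖(h u - L u) - (h u' - L u')‖ ≤ ε * ‖u - u'‖)
    (hd : ∀ u, ‖u‖ = 1 → ‖fderiv ℝ h u - L‖ ≤ ε) :
    HasSphereDegree (fun u => ‖h u‖⁻¹ • h u) 1 := by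
  -- The homogeneous extension differs from `L` by a `3ε`-Lipschitz map, hence is bijective. As it
  -- maps rays to rays, the normalized map is bijective on the sphere.
  set H : E n → E n := fun x => ‖x‖ • h (‖x‖⁻¹ • x) with hH
  have hHL : ApproximatesLinearOn H (L : E n →L[ℝ] E n) univ (3 * ε) := by
    intro x _ y _
    have h1 := norm_radial_sub_le (e := fun u => h u - L u) hb hl ε.2 x y
    have hL : ∀ x : E n, ‖x‖ • L (‖x‖⁻¹ • x) = L x := by
      intro x
      rcases eq_or_ne x 0 with rfl | hx
      · simp
      · rw [map_smul, smul_inv_smul₀ (norm_ne_zero_iff.2 hx)]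
    have h2 : H x - H y - (L : E n →L[ℝ] E n) (x - y) =
        ‖x‖ • (h (‖x‖⁻¹ • x) - L (‖x‖⁻¹ • x)) - ‖y‖ • (h (‖y‖⁻¹ • y) - L (‖y‖⁻¹ • y)) := by
      rw [smul_sub, smul_sub, hL, hL, ContinuousLinearEquiv.coe_coe, map_sub]
      simp only [hH]
      abel
    rw [h2]
    exact h1
  have hinj : Function.Injective H := injOn_univ.1 (hHL.injOn hsub)
  have hsurj : Function.Surjective H := hHL.surjective hsub
  have hH0 : H 0 = 0 := by simp [hH]
  have hHu : ∀ u, ‖u‖ = 1 → H u = h u := fun u hu => by simp [hH, hu]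
  have hHs : ∀ (a : ℝ) (x : E n), 0 < a → H (a • x) = a • H x := by
    intro a x ha
    simp only [hH, norm_smul, Real.norm_of_nonneg ha.le, mul_inv, smul_smul]
    rw [mul_right_comm, inv_mul_cancel₀ ha.ne', one_mul]
  have h0 : ∀ u, ‖u‖ = 1 → h u ≠ 0 := by
    intro u hu hz
    rw [← hHu u hu, ← hH0] at hz
    rw [hinj hz, norm_zero] at hu
    exact zero_ne_one hu
  have hpos : ∀ u, ‖u‖ = 1 → 0 < (sphereDeriv (fun u => ‖h u‖⁻¹ • h u) u).det := by
    intro u hu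
    refine det_sphereDeriv_normalize_pos hu ((hsm u hu).differentiableAt (by simp)) (h0 u hu)
      (hdet _ ?_)
    -- The radial part contributes `ε`, the tangential part `2ε`.
    refine ContinuousLinearMap.opNorm_le_bound _ (by positivity) fun x => ?_
    have hin : |inner ℝ u x| ≤ ‖x‖ := by simpa [hu] using abs_real_inner_le_norm u x
    have e1 : (radialDeriv h u - (L : E n →L[ℝ] E n)) x = inner ℝ u x • (h u - L u) +
        (fderiv ℝ h u - (L : E n →L[ℝ] E n)) (x - inner ℝ u x • u) := by
      simp only [radialDeriv, sub_apply, add_apply,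
        ContinuousLinearMap.smulRight_apply, innerSL_apply_apply, ContinuousLinearMap.comp_apply,
        ContinuousLinearMap.id_apply, map_sub, map_smul, ContinuousLinearEquiv.coe_coe, smul_sub]
      abel
    rw [e1]
    have e2 : ‖inner ℝ u x • (h u - L u)‖ ≤ ‖x‖ * ε := by
      rw [norm_smul, Real.norm_eq_abs]
      exact mul_le_mul hin (hb u hu) (norm_nonneg _) (norm_nonneg _)
    have e3 : ‖x - inner ℝ u x • u‖ ≤ 2 * ‖x‖ := by
      refine (norm_sub_le _ _).trans ?_
      rw [norm_smul, hu, mul_one, Real.norm_eq_abs]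
      linarith
    have e4 := (fderiv ℝ h u - (L : E n →L[ℝ] E n)).le_of_opNorm_le_of_le (hd u hu) e3
    refine (norm_add_le _ _).trans ?_
    linarith
  constructor
  · intro u hu
    exact (((hsm u hu).norm ℝ (h0 u hu)).inv (norm_ne_zero_iff.2 (h0 u hu))).smul (hsm u hu)
  · intro u hu
    simpa using norm_smul_inv_norm (𝕜 := ℝ) (h0 u hu)
  · intro hn
    have : Nonempty (Fin n) := ⟨⟨0, Nat.pos_of_ne_zero hn⟩⟩
    obtain ⟨y, hy⟩ := exists_norm_eq (E n) zero_le_one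
    exact ⟨y, hy, fun u hu _ => (hpos u hu).ne'⟩
  · rintro y ⟨hy, -⟩
    obtain ⟨x, hx⟩ := hsurj y
    have hx0 : x ≠ 0 := by
      rintro rfl
      rw [hH0] at hx
      rw [← hx, norm_zero] at hy
      exact zero_ne_one hy
    have hxn : 0 < ‖x‖ := norm_pos_iff.2 hx0
    have hu : ‖‖x‖⁻¹ • x‖ = 1 := by simpa using norm_smul_inv_norm (𝕜 := ℝ) hx0
    refine ⟨{‖x‖⁻¹ • x}, fun u => ?_, ?_⟩
    · rw [Finset.mem_singleton]
      constructor
      · rintro rfl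
        refine ⟨hu, ?_⟩
        have : h (‖x‖⁻¹ • x) = ‖x‖⁻¹ • y := by
          rw [← hHu _ hu, hHs _ _ (inv_pos.2 hxn), hx]
        simp only [this, norm_smul, hy, norm_inv, norm_norm, mul_one, inv_inv]
        rw [smul_inv_smul₀ hxn.ne']
      · rintro ⟨hu1, huy⟩
        have hpos' : 0 < ‖h u‖⁻¹ := inv_pos.2 (norm_pos_iff.2 (h0 u hu1))
        have h1 : H (‖h u‖⁻¹ • u) = H x := by
          rw [hHs _ _ hpos', hHu u hu1, hx]
          exact huy
        have h2 := hinj h1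
        rw [← h2, norm_smul, hu1, mul_one, Real.norm_of_nonneg hpos'.le,
          inv_smul_smul₀ hpos'.ne']
    · rw [Finset.sum_singleton, sign_pos (hpos _ hu)]
      rfl
  · intro _
    rfl

/-- The index of a vector field at a zero where its derivative has positive determinant is one. -/
theorem hasIndexAt_one_of_det_pos {n : ℕ} {v : E n → E n} {z : E n}
    (hv : ∀ᶠ y in 𝓝 z, ContDiffAt ℝ ∞ v y)
    (hvz : v z = 0) (hdet : 0 < (fderiv ℝ v z).det) : HasIndexAt v z 1 := by
  set L₀ := fderiv ℝ v z with hL₀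
  set L : E n ≃L[ℝ] E n := L₀.toContinuousLinearEquivOfDetNeZero hdet.ne' with hLdef
  have hL : (L : E n →L[ℝ] E n) = L₀ :=
    ContinuousLinearMap.coe_toContinuousLinearEquivOfDetNeZero L₀ hdet.ne'
  have hev : ∀ᶠ M in 𝓝 L₀, 0 < M.det :=
    ContinuousLinearMap.continuous_det.continuousAt.eventually (lt_mem_nhds hdet)
  obtain ⟨δ, hδ, hball⟩ := Metric.eventually_nhds_iff.1 hev
  -- `3ε` must keep the determinant positive and the perturbation of `L` invertible. The
  -- subsingleton alternative covers `n = 0`.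
  obtain ⟨ε, hε, hεδ, hsub⟩ : ∃ ε : ℝ≥0, 0 < ε ∧ 3 * ε < δ ∧
      (Subsingleton (E n) ∨ 3 * ε < ‖(L.symm : E n →L[ℝ] E n)‖₊⁻¹) := by
    lift δ to ℝ≥0 using hδ.le
    rcases L.subsingleton_or_nnnorm_symm_pos with hs | hN
    · refine ⟨δ / 4, div_pos hδ (by norm_num), ?_, Or.inl hs⟩
      push_cast; linarith
    · set m := min δ ‖(L.symm : E n →L[ℝ] E n)‖₊⁻¹ with hm
      have hm0 : 0 < m := lt_min hδ (inv_pos.2 hN)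
      have h3 : 3 * (m / 4) < m := by
        rw [← NNReal.coe_lt_coe]
        have : (0 : ℝ) < m := hm0
        push_cast; linarith
      refine ⟨m / 4, div_pos hm0 (by norm_num), ?_, Or.inr (h3.trans_le (min_le_right _ _))⟩
      exact_mod_cast h3.trans_le (min_le_left _ _)
  have hcont : ContinuousAt (fderiv ℝ v) z :=
    (hv.self_of_nhds.fderiv_right (m := 0) (by simp)).continuousAt
  have hgood : ∀ᶠ y in 𝓝 z, ContDiffAt ℝ ∞ v y ∧ ‖fderiv ℝ v y - L₀‖ ≤ ε := by
    refine hv.and ?_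
    have := hcont.eventually (Metric.closedBall_mem_nhds L₀ (ε := ε) hε)
    filter_upwards [this] with y hy using mem_closedBall_iff_norm.1 hy
  obtain ⟨ρ, hρ, hρgood⟩ := Metric.eventually_nhds_iff_ball.1 hgood
  filter_upwards [Ioo_mem_nhdsGT hρ] with r hr
  have hr0 : r ≠ 0 := hr.1.ne'
  have hmem : ∀ u : E n, ‖u‖ ≤ 1 → z + r • u ∈ Metric.ball z ρ := by
    intro u hu
    rw [mem_ball_iff_norm, add_sub_cancel_left, norm_smul, Real.norm_of_nonneg hr.1.le]
    nlinarith [hr.1, hr.2]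
  -- Rescaling does not affect the normalized map, and the derivative of `h` at `u` is that of `v`
  -- at `z + r • u`, which is close to `L`.
  set h : E n → E n := fun u => r⁻¹ • v (z + r • u) with hh
  have hfd : ∀ u : E n, ‖u‖ ≤ 1 → HasFDerivAt h (fderiv ℝ v (z + r • u)) u := by
    intro u hu
    have h1 : HasFDerivAt (fun u : E n => z + r • u) (r • ContinuousLinearMap.id ℝ (E n)) u :=
      ((hasFDerivAt_id u).const_smul r).const_add z
    have h2 := (((hρgood _ (hmem u hu)).1.differentiableAt (by simp)).hasFDerivAt.comp u
      h1).const_smul r⁻¹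
    refine h2.congr_fderiv ?_
    ext1 x
    simp [smul_smul, hr0]
  -- Proved on the closed ball, which is convex, unlike the sphere; the centre `u' = 0` then yields
  -- the sup bound.
  have hlip : ∀ u u' : E n, ‖u‖ ≤ 1 → ‖u'‖ ≤ 1 →
      ‖(h u - L u) - (h u' - L u')‖ ≤ ε * ‖u - u'‖ := by
    intro u u' hu hu'
    refine (convex_closedBall (0 : E n) 1).norm_image_sub_le_of_norm_hasFDerivWithin_le
      (f := fun u => h u - L u) (f' := fun u => fderiv ℝ v (z + r • u) - (L : E n →L[ℝ] E n)) (fun x hx => ?_)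
      (fun x hx => ?_) (mem_closedBall_zero_iff.2 hu') (mem_closedBall_zero_iff.2 hu)
    · exact ((hfd x (mem_closedBall_zero_iff.1 hx)).sub L.hasFDerivAt).hasFDerivWithinAt
    · rw [hL]
      exact (hρgood _ (hmem x (mem_closedBall_zero_iff.1 hx))).2
  have key := hasSphereDegree_normalize L (h := h) (ε := ε) hsub (fun M hM => hball ?_)
    (fun u hu => ?_) (fun u hu => ?_) (fun u u' hu hu' => hlip u u' hu.le hu'.le)
    (fun u hu => ?_)
  · convert key using 2 with u
    simp only [hh, norm_smul, norm_inv, Real.norm_of_nonneg hr.1.le, mul_inv, inv_inv, smul_smul]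
    rw [mul_right_comm, mul_inv_cancel₀ hr0, one_mul]
  · rw [dist_eq_norm, ← hL]
    exact hM.trans_lt hεδ
  · have h1 : ContDiffAt ℝ ∞ v (z + r • u) := (hρgood _ (hmem u hu.le)).1
    have h2 : ContDiffAt ℝ ∞ (fun u : E n => z + r • u) u := by fun_prop
    exact (h1.comp u h2).const_smul r⁻¹
  · have := hlip u 0 hu.le (by simp)
    simpa [hh, hvz, hu] using this
  · rw [(hfd u hu.le).fderiv, hL]
    exact (hρgood _ (hmem u hu.le)).2

/-! ### Restriction to the vectors with bounded orbit -/

section BoundedOrbits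

variable {V : Type*} [NormedAddCommGroup V] [NormedSpace ℝ V]

/-- The subspace of the vectors with bounded orbit under the one-parameter group generated
by `B`. -/
def boundedOrbits (B : V →L[ℝ] V) : Submodule ℝ V where
  carrier := {u | ∃ C : ℝ, ∀ t : ℝ, ‖NormedSpace.exp (t • B) u‖ ≤ C}
  zero_mem' := ⟨0, fun t => by simp⟩
  add_mem' := by
    rintro u w ⟨C, hC⟩ ⟨D, hD⟩
    refine ⟨C + D, fun t => ?_⟩
    rw [map_add]
    exact (norm_add_le _ _).trans (add_le_add (hC t) (hD t))
  smul_mem' := by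
    rintro c u ⟨C, hC⟩
    refine ⟨‖c‖ * C, fun t => ?_⟩
    rw [map_smul, norm_smul]
    exact mul_le_mul_of_nonneg_left (hC t) (norm_nonneg c)

theorem map_mem_boundedOrbits (B : V →L[ℝ] V) {u : V} (hu : u ∈ boundedOrbits B) :
    B u ∈ boundedOrbits B := by
  obtain ⟨C, hC⟩ := hu
  refine ⟨‖B‖ * C, fun t => ?_⟩
  have hcomm : NormedSpace.exp (t • B) * B = B * NormedSpace.exp (t • B) :=
    (((Commute.refl B).smul_left t).exp_left).eq
  have : NormedSpace.exp (t • B) (B u) = B (NormedSpace.exp (t • B) u) :=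
    DFunLike.congr_fun hcomm u
  rw [this]
  exact B.le_of_opNorm_le_of_le le_rfl (hC t)

variable [FiniteDimensional ℝ V]

theorem hasDerivAt_exp_smul_apply (B : V →L[ℝ] V) (u : V) (t : ℝ) :
    HasDerivAt (fun s : ℝ => NormedSpace.exp (s • B) u) (NormedSpace.exp (t • B) (B u)) t := by
  have : CompleteSpace V := FiniteDimensional.complete ℝ V
  exact (ContinuousLinearMap.apply ℝ V u).hasFDerivAt.comp_hasDerivAt t
    (hasDerivAt_exp_smul_const (𝕂 := ℝ) B t)

theorem exp_smul_apply_eq_self {B : V →L[ℝ] V} {u : V} (hu : B u = 0) (t : ℝ) :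
    NormedSpace.exp (t • B) u = u := by
  have h := fun s => hasDerivAt_exp_smul_apply B u s
  simp only [hu, map_zero] at h
  have := is_const_of_deriv_eq_zero (fun s => (h s).differentiableAt) (fun s => (h s).deriv) t 0
  simpa using this

theorem exp_smul_intertwine {U : Type*} [NormedAddCommGroup U] [NormedSpace ℝ U]
    [FiniteDimensional ℝ U] (B : V →L[ℝ] V) (A : U →L[ℝ] U) (ι : U →L[ℝ] V)
    (h : ∀ u, ι (A u) = B (ι u)) (t : ℝ) (u : U) :
    ι (NormedSpace.exp (t • A) u) = NormedSpace.exp (t • B) (ι u) := by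
  have : CompleteSpace V := FiniteDimensional.complete ℝ V
  have : CompleteSpace U := FiniteDimensional.complete ℝ U
  have h1 := (ι.comp (ContinuousLinearMap.apply ℝ U u)).hasSum
    (NormedSpace.exp_series_hasSum_exp' (𝕂 := ℝ) (t • A))
  have h2 := (ContinuousLinearMap.apply ℝ V (ι u)).hasSum
    (NormedSpace.exp_series_hasSum_exp' (𝕂 := ℝ) (t • B))
  refine h1.unique (h2.congr_fun fun k => ?_)
  have hk : ι ((A ^ k) u) = (B ^ k) (ι u) := by
    induction k with
    | zero => rfl
    | succ k ih =>
      rw [pow_succ', pow_succ', mul_apply_eq_comp, mul_apply_eq_comp, h, ih]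
  change ι (((k.factorial : ℝ)⁻¹ • (t • A) ^ k) u) = ((k.factorial : ℝ)⁻¹ • (t • B) ^ k) (ι u)
  rw [smul_pow, smul_pow, smul_apply, smul_apply, smul_apply, smul_apply, map_smul, map_smul, hk]

/-- The group of `B` may be unbounded on `V`. On `U` each orbit is bounded, hence the group is
uniformly bounded by Banach–Steinhaus, and a linear left inverse of `ι` moves `G` into `U`. -/
theorem no_eigenvector_of_isolated_zero_of_intertwine {n : ℕ} {U : Type*} [NormedAddCommGroup U]
    [NormedSpace ℝ U] [FiniteDimensional ℝ U] (B : V →L[ℝ] V) (A : U →L[ℝ] U) (ι : U →ₗᵢ[ℝ] V)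
    (h : ∀ u, ι (A u) = B (ι u)) (hU : ∀ u, ι u ∈ boundedOrbits B)
    {v : E n → E n} {G : E n → V} {z : E n}
    (hmem : ∀ᶠ y in 𝓝 z, G y ∈ range ι)
    (hv : DifferentiableAt ℝ v z) (hG : ContDiffAt ℝ 2 G z)
    (heq : ∀ᶠ y in 𝓝 z, fderiv ℝ G y (v y) = B (G y))
    (hinj : Function.Injective (fderiv ℝ G z)) (hvz : v z = 0)
    (hiso : ∀ᶠ y in 𝓝[≠] z, v y ≠ 0) (c : ℝ) (w : E n) (hw : fderiv ℝ v z w = c • w) :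
    w = 0 := by
  have : CompleteSpace U := FiniteDimensional.complete ℝ U
  obtain ⟨C, hC⟩ := banach_steinhaus (g := fun t : ℝ => NormedSpace.exp (t • A)) (by
    intro u
    obtain ⟨C, hC⟩ := hU u
    refine ⟨C, fun t => ?_⟩
    rw [← ι.norm_map]
    exact (congrArg norm (exp_smul_intertwine B A ι.toContinuousLinearMap h t u)).trans_le (hC t))
  obtain ⟨q, hq⟩ := ι.toLinearMap.exists_leftInverse_of_injective
    (LinearMap.ker_eq_bot.2 ι.injective)
  set R : V →L[ℝ] U := LinearMap.toContinuousLinearMap q with hR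
  have hRS : ∀ u : U, R (ι u) = u := fun u => LinearMap.congr_fun hq u
  have hRG : ∀ᶠ y in 𝓝 z, ι (R (G y)) = G y := by
    filter_upwards [hmem] with y ⟨u, hu⟩
    rw [← hu, hRS]
  have hfd : ∀ᶠ y in 𝓝 z, HasFDerivAt (fun y => R (G y)) (R.comp (fderiv ℝ G y)) y := by
    filter_upwards [hG.eventually (by simp)] with y hy using
      R.hasFDerivAt.comp y (hy.differentiableAt (by norm_num)).hasFDerivAt
  refine no_eigenvector_of_isolated_zero A hC (G := fun y => R (G y)) hv
    (R.contDiff.contDiffAt.comp z hG) ?_ ?_ hvz hiso c w hw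
  · filter_upwards [hfd, heq, hRG] with y h1 h2 h3
    rw [h1.fderiv, ContinuousLinearMap.comp_apply, h2, ← hRS (A (R (G y))), h, h3]
  · have h1 : HasFDerivAt G (ι.toContinuousLinearMap.comp (fderiv ℝ (fun y => R (G y)) z)) z :=
      (ι.toContinuousLinearMap.hasFDerivAt.comp z
        hfd.self_of_nhds.differentiableAt.hasFDerivAt).congr_of_eventuallyEq
          (hRG.mono fun y hy => hy.symm)
    rw [h1.fderiv, ContinuousLinearMap.coe_comp] at hinj
    exact Function.Injective.of_comp hinj

end BoundedOrbits

theorem exp_toEuclideanCLM {m : ℕ} (A : Matrix (Fin m) (Fin m) ℝ) :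
    Matrix.toEuclideanCLM (𝕜 := ℝ) (NormedSpace.exp A) =
      NormedSpace.exp (Matrix.toEuclideanCLM (𝕜 := ℝ) A) := by
  -- An auxiliary norm; the identity does not depend on its choice.
  let : NormedRing (Matrix (Fin m) (Fin m) ℝ) := Matrix.linftyOpNormedRing
  let : NormedAlgebra ℝ (Matrix (Fin m) (Fin m) ℝ) := Matrix.linftyOpNormedAlgebra
  let : NormedAlgebra ℚ (Matrix (Fin m) (Fin m) ℝ) := NormedAlgebra.restrictScalars ℚ ℝ _
  let : NormedAlgebra ℚ (E m →L[ℝ] E m) := NormedAlgebra.restrictScalars ℚ ℝ _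
  exact NormedSpace.map_exp (Matrix.toEuclideanCLM (𝕜 := ℝ) (n := Fin m))
    (LinearMap.continuous_of_finiteDimensional
      (Matrix.toEuclideanCLM (𝕜 := ℝ) (n := Fin m)).toAlgEquiv.toLinearMap) A

/-! ### Flow, generator and embedding in charts -/

section Manifold

variable {n : ℕ} {X : Type*} [TopologicalSpace X] [ChartedSpace (E n) X]

/-- In the normal form `u ↦ (u, 0)` of an immersion, projecting to the first factor gives a map `H`,
differentiable at `F x`, with `H ∘ F = φ` near `x`. The chain rule then makes `DH` a left inverse of
the derivative. -/
theorem injective_fderiv_comp_chart_symm {m : ℕ} [IsManifold (𝓡 n) ∞ X] {F : X → E m}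
    (hF : Manifold.IsImmersion (𝓡 n) (𝓡 m) ∞ F) {φ : OpenPartialHomeomorph X (E n)}
    (hφ : φ ∈ IsManifold.maximalAtlas (𝓡 n) ∞ X) {x : X} (hx : x ∈ φ.source) :
    Function.Injective (fderiv ℝ (F ∘ φ.symm) (φ x)) := by
  have h := hF.isImmersionAt x
  set a := h.domChart with ha
  set b := h.codChart with hb
  have hxa : x ∈ a.source := h.mem_domChart_source
  have hxb : F x ∈ b.source := h.mem_codChart_source
  set H : E m → E n := fun p => φ (a.symm (h.equiv.symm (b p)).1) with hH
  have hax : ∀ᶠ x' in 𝓝 x, (h.equiv.symm (b (F x'))).1 = a x' := by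
    filter_upwards [a.open_source.mem_nhds hxa] with x' hx'
    have ht : a x' ∈ (a.extend (𝓡 n)).target := by
      rw [OpenPartialHomeomorph.extend_target]
      simpa using a.map_source hx'
    have h1 := h.writtenInCharts ht
    have h2 : b (F (a.symm (a x'))) = h.equiv (a x', 0) := by
      simpa using h1
    rw [a.left_inv hx'] at h2
    rw [h2, ContinuousLinearEquiv.symm_apply_apply]
  have hHx : ∀ᶠ x' in 𝓝 x, H (F x') = φ x' := by
    filter_upwards [hax, a.open_source.mem_nhds hxa] with x' h1 h2
    simp only [hH, h1, a.left_inv h2]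
  have hHd : DifferentiableAt ℝ H (F x) := by
    have h1 : ContMDiffAt (𝓡 m) (𝓡 m) ∞ b (F x) :=
      (contMDiffOn_of_mem_maximalAtlas h.codChart_mem_maximalAtlas).contMDiffAt
        (b.open_source.mem_nhds hxb)
    have h2 : ContDiffAt ℝ ∞ (fun p => (h.equiv.symm (b p)).1) (F x) := by
      have h3 : ContDiffAt ℝ ∞ b (F x) := h1.contDiffAt
      exact ((contDiff_fst.comp h.equiv.symm.contDiff).contDiffAt).comp (F x) h3
    have h4 : ContMDiffAt (𝓡 n) (𝓡 n) ∞ a.symm (a x) :=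
      (contMDiffOn_symm_of_mem_maximalAtlas h.domChart_mem_maximalAtlas).contMDiffAt
        (a.open_target.mem_nhds (a.map_source hxa))
    have h5 : ContMDiffAt (𝓡 n) (𝓡 n) ∞ φ x :=
      (contMDiffOn_of_mem_maximalAtlas hφ).contMDiffAt (φ.open_source.mem_nhds hx)
    have h6 : ContMDiffAt (𝓡 n) (𝓡 n) ∞ (φ ∘ a.symm) (a x) :=
      ContMDiffAt.comp_of_eq h5 h4 (a.left_inv hxa)
    have h7 : ContDiffAt ℝ ∞ (φ ∘ a.symm) (a x) := h6.contDiffAt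
    rw [← hax.self_of_nhds] at h7
    exact (h7.comp (F x) h2).differentiableAt (by simp)
  have hG : DifferentiableAt ℝ (F ∘ φ.symm) (φ x) := by
    have h1 : ContMDiffAt (𝓡 n) (𝓡 n) ∞ φ.symm (φ x) :=
      (contMDiffOn_symm_of_mem_maximalAtlas hφ).contMDiffAt
        (φ.open_target.mem_nhds (φ.map_source hx))
    have h2 : ContMDiffAt (𝓡 n) (𝓡 m) ∞ (F ∘ φ.symm) (φ x) :=
      hF.contMDiff.contMDiffAt.comp (φ x) h1
    exact h2.contDiffAt.differentiableAt (by simp)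
  have hid : (fun y => H ((F ∘ φ.symm) y)) =ᶠ[𝓝 (φ x)] id := by
    have h1 := φ.symm.continuousAt (x := φ x) (φ.map_source hx)
    rw [ContinuousAt, φ.left_inv hx] at h1
    filter_upwards [h1.eventually hHx, φ.open_target.mem_nhds (φ.map_source hx)] with y hy hyt
    simpa [φ.right_inv hyt] using hy
  have hHd' : DifferentiableAt ℝ H ((F ∘ φ.symm) (φ x)) := by
    simpa [φ.left_inv hx] using hHd
  have hcomp := (hHd'.hasFDerivAt.comp (φ x) hG.hasFDerivAt).unique
    ((hasFDerivAt_id (φ x)).congr_of_eventuallyEq hid)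
  intro u w huw
  have h1 := DFunLike.congr_fun hcomp u
  have h2 := DFunLike.congr_fun hcomp w
  simp only [ContinuousLinearMap.comp_apply, ContinuousLinearMap.id_apply] at h1 h2
  rw [← h1, ← h2, huw]

theorem contDiffAt_flow_in_chart [IsManifold (𝓡 n) ∞ X] {Φ : Flow ℝ X} (hΦ : IsSmoothFlow n Φ)
    {φ : OpenPartialHomeomorph X (E n)} (hφ : φ ∈ IsManifold.maximalAtlas (𝓡 n) ∞ X)
    {y : E n} (hy : y ∈ φ.target) :
    ContDiffAt ℝ ∞ (fun p : ℝ × E n => φ (Φ p.1 (φ.symm p.2))) (0, y) := by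
  have h1 : ContMDiffAt (𝓡 n) (𝓡 n) ∞ φ.symm y :=
    (contMDiffOn_symm_of_mem_maximalAtlas hφ).contMDiffAt (φ.open_target.mem_nhds hy)
  have h5 : ContMDiffAt (𝓡 n) (𝓡 n) ∞ φ (φ.symm y) :=
    (contMDiffOn_of_mem_maximalAtlas hφ).contMDiffAt (φ.open_source.mem_nhds (φ.map_target hy))
  have h2 : ContMDiffAt 𝓘(ℝ, ℝ × E n) (𝓡 n) ∞ (fun p : ℝ × E n => φ.symm p.2) (0, y) :=
    ContMDiffAt.comp (0, y) (g := φ.symm) (f := Prod.snd) h1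
      (contDiff_snd.contDiffAt.contMDiffAt)
  have h3 : ContMDiffAt 𝓘(ℝ, ℝ × E n) 𝓘(ℝ, ℝ) ∞ (fun p : ℝ × E n => p.1) (0, y) :=
    contDiff_fst.contDiffAt.contMDiffAt
  have h4 : ContMDiffAt 𝓘(ℝ, ℝ × E n) (𝓡 n) ∞
      (fun p : ℝ × E n => Φ p.1 (φ.symm p.2)) (0, y) :=
    ContMDiffAt.comp (0, y) (g := fun p : ℝ × X => Φ p.1 p.2) hΦ.contMDiffAt (h3.prodMk h2)
  have h6 := ContMDiffAt.comp_of_eq (g := φ) h5 h4 (by simp)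
  exact h6.contDiffAt

theorem hasDerivAt_flow_in_chart [IsManifold (𝓡 n) ∞ X] {Φ : Flow ℝ X} (hΦ : IsSmoothFlow n Φ)
    {φ : OpenPartialHomeomorph X (E n)} (hφ : φ ∈ IsManifold.maximalAtlas (𝓡 n) ∞ X)
    {y : E n} (hy : y ∈ φ.target) :
    HasDerivAt (fun t : ℝ => φ (Φ t (φ.symm y))) (chartRep (generator n Φ) φ y) 0 := by
  have h5 : ContMDiffAt (𝓡 n) (𝓡 n) ∞ φ (φ.symm y) :=
    (contMDiffOn_of_mem_maximalAtlas hφ).contMDiffAt (φ.open_source.mem_nhds (φ.map_target hy))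
  have h1 : ContMDiffAt 𝓘(ℝ, ℝ) (𝓡 n) ∞ (fun t : ℝ => Φ t (φ.symm y)) 0 :=
    ContMDiffAt.comp (0 : ℝ) (g := fun p : ℝ × X => Φ p.1 p.2) hΦ.contMDiffAt
      (contMDiffAt_id.prodMk contMDiffAt_const)
  have h6 := h5.mdifferentiableAt (by simp)
  have h0 : Φ 0 (φ.symm y) = φ.symm y := Φ.map_zero_apply _
  -- The tangent space depends on the base point, and `Φ 0 p = p` is not definitional; all fibres
  -- are read as `E n` to transport along it.
  have hpt : ∀ p q : X, p = q → ∀ w : E n,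
      (mfderiv (𝓡 n) 𝓘(ℝ, E n) φ p : E n →L[ℝ] E n) w =
        (mfderiv (𝓡 n) 𝓘(ℝ, E n) φ q : E n →L[ℝ] E n) w := by
    rintro p _ rfl w
    rfl
  have h6' : MDifferentiableAt (𝓡 n) 𝓘(ℝ, E n) φ (Φ 0 (φ.symm y)) := by rw [h0]; exact h6
  have h2 := (h6'.hasMFDerivAt.comp (0 : ℝ) (h1.mdifferentiableAt (by simp)).hasMFDerivAt)
  have h3 : HasFDerivAt (𝕜 := ℝ) (E := ℝ) (F := E n) (fun t : ℝ => φ (Φ t (φ.symm y))) _ 0 :=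
    h2.hasFDerivAt
  have h4 := h3.hasDerivAt
  refine h4.congr_deriv ?_
  exact hpt _ _ h0 _

/-- In the chart the generator is the time derivative at `0` of the jointly smooth local flow. -/
theorem contDiffAt_chartRep_generator [IsManifold (𝓡 n) ∞ X] {Φ : Flow ℝ X}
    (hΦ : IsSmoothFlow n Φ) {φ : OpenPartialHomeomorph X (E n)}
    (hφ : φ ∈ IsManifold.maximalAtlas (𝓡 n) ∞ X) {y : E n} (hy : y ∈ φ.target) :
    ContDiffAt ℝ ∞ (chartRep (generator n Φ) φ) y := by
  set K : ℝ × E n → E n := fun p => φ (Φ p.1 (φ.symm p.2)) with hK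
  have hv : ∀ y ∈ φ.target, chartRep (generator n Φ) φ y = fderiv ℝ K (0, y) (1, 0) := by
    intro y hy
    have h1 := ((contDiffAt_flow_in_chart hΦ hφ hy).differentiableAt (by simp)).hasFDerivAt
    have h2 : HasDerivAt (fun t : ℝ => (t, y)) ((1 : ℝ), (0 : E n)) 0 :=
      (hasDerivAt_id (0 : ℝ)).prodMk (hasDerivAt_const (0 : ℝ) y)
    exact (hasDerivAt_flow_in_chart hΦ hφ hy).unique
      (HasFDerivAt.comp_hasDerivAt (l := K) (0 : ℝ) h1 h2)
  have h1 : ContDiffAt ℝ ∞ (fderiv ℝ K) (0, y) :=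
    (contDiffAt_flow_in_chart hΦ hφ hy).fderiv_right (m := ∞) (by simp)
  have h2 : ContDiffAt ℝ ∞ (fun y : E n => ((0 : ℝ), y)) y :=
    contDiffAt_const.prodMk contDiffAt_id
  have h3 : ContDiffAt ℝ ∞ (fun y => fderiv ℝ K (0, y) (1, 0)) y :=
    (h1.comp y h2).clm_apply contDiffAt_const
  refine h3.congr_of_eventuallyEq ?_
  filter_upwards [φ.open_target.mem_nhds hy] with y hy using hv y hy

theorem even_and_hasIndexAt_of_isolated [CompactSpace X] [IsManifold (𝓡 n) ∞ X] {Φ : Flow ℝ X}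
    (hΦ : IsSmoothFlow n Φ) (hlin : IsSmoothlyLinearizable n Φ) {x : X}
    (hx : IsIsolatedEquilibrium Φ x) {φ : OpenPartialHomeomorph X (E n)}
    (hφ : φ ∈ IsManifold.maximalAtlas (𝓡 n) ∞ X) (hxφ : x ∈ φ.source) :
    Even n ∧ HasIndexAt (chartRep (generator n Φ) φ) (φ x) 1 := by
  obtain ⟨m, F, B₀, hF, hFB⟩ := hlin
  set B : E m →L[ℝ] E m := Matrix.toEuclideanCLM (𝕜 := ℝ) B₀ with hB
  have hexp : ∀ t : ℝ, Matrix.toEuclideanCLM (𝕜 := ℝ) (NormedSpace.exp (t • B₀)) =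
      NormedSpace.exp (t • B) := by
    intro t
    rw [exp_toEuclideanCLM, map_smul]
  have hFΦ : ∀ (t : ℝ) (x : X), F (Φ t x) = NormedSpace.exp (t • B) (F x) := by
    intro t x
    rw [hFB, hexp]
  have hFc : ContMDiff (𝓡 n) (𝓡 m) ∞ F := hF.contMDiff
  set v := chartRep (generator n Φ) φ with hv
  set G : E n → E m := F ∘ φ.symm with hG
  have hzt : φ x ∈ φ.target := φ.map_source hxφ
  have htgt : ∀ᶠ y in 𝓝 (φ x), y ∈ φ.target := φ.open_target.mem_nhds hzt
  have hvs : ∀ y ∈ φ.target, ContDiffAt ℝ ∞ v y := fun y hy =>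
    contDiffAt_chartRep_generator hΦ hφ hy
  have hGs : ∀ y ∈ φ.target, ContDiffAt ℝ ∞ G y := by
    intro y hy
    have h1 : ContMDiffAt (𝓡 n) (𝓡 n) ∞ φ.symm y :=
      (contMDiffOn_symm_of_mem_maximalAtlas hφ).contMDiffAt (φ.open_target.mem_nhds hy)
    have h2 : ContMDiffAt (𝓡 n) (𝓡 m) ∞ G y := hFc.contMDiffAt.comp y h1
    exact h2.contDiffAt
  -- The derivative at `t = 0` of the conjugacy `hFΦ`.
  have hGv : ∀ y ∈ φ.target, fderiv ℝ G y (v y) = B (G y) := by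
    intro y hy
    have h0 : φ (Φ 0 (φ.symm y)) = y := by rw [Φ.map_zero_apply, φ.right_inv hy]
    have h1 : HasFDerivAt G (fderiv ℝ G y) (φ (Φ 0 (φ.symm y))) := by
      rw [h0]
      exact ((hGs y hy).differentiableAt (by simp)).hasFDerivAt
    have h2 := h1.comp_hasDerivAt (0 : ℝ) (hasDerivAt_flow_in_chart hΦ hφ hy)
    have h3 := hasDerivAt_exp_smul_apply B (G y) 0
    simp only [zero_smul, NormedSpace.exp_zero, one_apply_eq_self] at h3
    refine h2.unique (h3.congr_of_eventuallyEq ?_)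
    have h4 : ContinuousAt (fun t : ℝ => Φ t (φ.symm y)) 0 :=
      (Φ.continuous continuous_id continuous_const).continuousAt
    have h5 : ∀ᶠ t in 𝓝 (0 : ℝ), Φ t (φ.symm y) ∈ φ.source := by
      refine h4.eventually (φ.open_source.mem_nhds ?_)
      change Φ 0 (φ.symm y) ∈ φ.source
      rw [Φ.map_zero_apply]
      exact φ.map_target hy
    filter_upwards [h5] with t ht
    simp only [hG, Function.comp_apply, φ.left_inv ht, hFΦ]
  have hvz : v (φ x) = 0 := by
    have h1 := hasDerivAt_flow_in_chart hΦ hφ hzt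
    have h2 : (fun t : ℝ => φ (Φ t (φ.symm (φ x)))) = fun _ => φ x := by
      funext t
      rw [φ.left_inv hxφ, hx.1 t]
    rw [h2] at h1
    exact h1.unique (hasDerivAt_const _ _)
  have hiso : ∀ᶠ y in 𝓝[≠] (φ x), v y ≠ 0 := by
    have h1 := φ.symm.continuousAt (x := φ x) hzt
    rw [ContinuousAt, φ.left_inv hxφ] at h1
    have h2 := h1.eventually (eventually_nhdsWithin_iff.1 hx.2)
    rw [eventually_nhdsWithin_iff]
    filter_upwards [h2, htgt] with y hy hyt hyz hvy
    -- A zero of `v` is an equilibrium: `B (G y) = 0`, so `exp(tB)` fixes `G y`, and `F` is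
    -- injective.
    refine hy (fun hyx => hyz ?_) fun t => hF.isEmbedding.injective ?_
    · rw [mem_singleton_iff, ← φ.right_inv hyt, hyx]
    · rw [hFΦ]
      refine exp_smul_apply_eq_self ?_ t
      have := hGv y hyt
      rw [hvy, map_zero] at this
      exact this.symm
  -- The orbit of a point of `F(X)` stays in `F(X)`, which is compact.
  have hbd : ∀ y, G y ∈ boundedOrbits B := by
    intro y
    obtain ⟨C, hC⟩ := (isCompact_range hFc.continuous).isBounded.exists_norm_le
    refine ⟨C, fun t => ?_⟩
    rw [hG, Function.comp_apply, ← hFΦ]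
    exact hC _ (mem_range_self _)
  have hdet := det_pos_and_even_of_no_eigenvector (fderiv ℝ v (φ x))
    (no_eigenvector_of_isolated_zero_of_intertwine B
      ((B.comp (boundedOrbits B).subtypeL).codRestrict (boundedOrbits B)
        (fun u => map_mem_boundedOrbits B u.2))
      (boundedOrbits B).subtypeₗᵢ (fun _ => rfl) (fun u => u.2) (G := G)
      (Eventually.of_forall fun y => ⟨⟨G y, hbd y⟩, rfl⟩) ((hvs _ hzt).differentiableAt (by simp))
      ((hGs _ hzt).of_le (by norm_cast)) (htgt.mono hGv)
      (injective_fderiv_comp_chart_symm hF.isImmersion hφ hxφ) hvz hiso)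
  exact ⟨hdet.2, hasIndexAt_one_of_det_pos (htgt.mono hvs) hvz hdet.1⟩

end Manifold

end LinFlow

end

theorem mainTheorem5 (n : ℕ) {X : Type*} [TopologicalSpace X] [T2Space X] [CompactSpace X]
    [ConnectedSpace X] [ChartedSpace (EuclideanSpace ℝ (Fin n)) X] [IsManifold (𝓡 n) ∞ X]
    (Φ : Flow ℝ X) (hΦ : LinFlow.IsSmoothFlow n Φ)
    (hlin : LinFlow.IsSmoothlyLinearizable n Φ)
    (hiso : ∃ x : X, LinFlow.IsIsolatedEquilibrium Φ x) :
    Even n ∧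
      ∀ x : X, LinFlow.IsIsolatedEquilibrium Φ x →
        LinFlow.HasHopfIndex (LinFlow.generator n Φ) x 1 := by
  refine ⟨?_, fun x hx φ hφ hxφ =>
    (LinFlow.even_and_hasIndexAt_of_isolated hΦ hlin hx hφ hxφ).2⟩
  obtain ⟨x, hx⟩ := hiso
  exact (LinFlow.even_and_hasIndexAt_of_isolated hΦ hlin hx
    (IsManifold.chart_mem_maximalAtlas (I := 𝓡 n) (n := ∞) x)
    (mem_chart_source (LinFlow.E n) x)).1
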